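/- Let $\gamma$ be the Euler--Mascheroni constant, and for $\alpha\in\mathbb{R}$ and $\omega>0$ put $e_\alpha:=-4e^{-2(2\pi\alpha+\gamma)}$ and $\beta_\alpha(\omega):=\alpha+\frac{\gamma}{2\pi}+\frac1{2\pi}\ln\frac{\sqrt\omega}{2}$. Let $\mathcal{G}_\omega\in L^2(\mathbb{R}^2)$ be the Green function $\mathcal{G}_\omega(x)=(2\pi)^{-2}\int_{\mathbb{R}^2}\frac{e^{-\mathrm{i}x\cdot\xi}}{\omega+|\xi|^2}\,\mathrm{d}\xi$ (the integral being an $L^2$ Fourier transform), so that $(-\Delta+\omega)\mathcal{G}_\omega=\delta$. The point-perturbed Laplacian $-\Delta_\alpha$ is the self-adjoint operator on $L^2(\mathbb{R}^2)=L^2(\mathbb{R}^2;\mathbb{C})$ given by $$\mathcal{D}(-\Delta_\alpha)=\Big\{g=f+\tfrac{f(0)}{\beta_\alpha(\omega)}\,\mathcal{G}_\omega\;\Big|\;f\in H^2(\mathbb{R}^2)\Big\},\qquad(\omega-\Delta_\alpha)g=(\omega-\Delta)f,$$ where $\omega\in(0,\infty)\setminus\{-e_\alpha\}$ is arbitrary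 (the operator does not depend on it) and $f(0)$ is the value of the continuous representative of $f$. The energy space $H^1_\alpha(\mathbb{R}^2)$ is the domain of the closure $(-\Delta_\alpha)[\,\cdot\,]$ of the quadratic form $g\mapsto\langle-\Delta_\alpha g,g\rangle_{L^2}$, $g\in\mathcal{D}(-\Delta_\alpha)$, with the norm $\|g\|_{H^1_\alpha}^2:=(-\Delta_\alpha)[g]+(1-e_\alpha)\|g\|_{L^2}^2$. Then for every $\alpha\in\mathbb{R}$ and every $p\in[2,\infty)$ there is a constant $C=C(\alpha,p)>0$ such that every $g\in H^1_\alpha(\mathbb{R}^2)$ belongs to $L^p(\mathbb{R}^2)$ and $$\|g\|_{L^p}\;\le\;C\,\|g\|_{H^1_\alpha}^{1-\frac2p}\,\|g\|_{L^2}^{\frac2p}.$$ -/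

import Mathlib

open MeasureTheory Filter
open scoped Topology FourierTransform Laplacian ENNReal

noncomputable section

namespace PointInteraction

/-- The Euclidean plane `ℝ²`. -/
abbrev Plane : Type := EuclideanSpace ℝ (Fin 2)

/-- The complex Hilbert space `L²(ℝ²)`. -/
abbrev L2 : Type := Lp ℂ 2 (volume : Measure Plane)

/-- The function `η ↦ 1 / (ω + |2πη|²)` on `ℝ²`. -/
def greenSymbol (ω : ℝ) (η : Plane) : ℂ :=
  (((ω + (2 * Real.pi * ‖η‖) ^ 2)⁻¹ : ℝ) : ℂ)

/-- For `ω > 0` the function `η ↦ 1 / (ω + |2πη|²)` is square-integrable on `ℝ²`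
(it is not integrable). -/
theorem memLp_greenSymbol {ω : ℝ} (hω : 0 < ω) :
    MemLp (greenSymbol ω) 2 (volume : Measure Plane) := by
  have hpos : ∀ η : Plane, 0 < ω + (2 * Real.pi * ‖η‖) ^ 2 := fun η => by positivity
  have hcont : Continuous (fun η : Plane => (ω + (2 * Real.pi * ‖η‖) ^ 2)⁻¹) :=
    Continuous.inv₀ (by fun_prop) (fun η => (hpos η).ne')
  have hint : Integrable (fun η : Plane => (1 + ‖η‖ ^ 2) ^ (-(4 : ℝ) / 2)) :=
    integrable_rpow_neg_one_add_norm_sq (by simp; norm_num)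
  have hreal : MemLp (fun η : Plane => (ω + (2 * Real.pi * ‖η‖) ^ 2)⁻¹) 2 volume := by
    rw [memLp_two_iff_integrable_sq hcont.aestronglyMeasurable]
    set m : ℝ := min ω 1 with hm
    have hm0 : 0 < m := lt_min hω one_pos
    refine (hint.const_mul ((m⁻¹) ^ 2)).mono' (by fun_prop) (Eventually.of_forall fun η => ?_)
    have h1 : m * (1 + ‖η‖ ^ 2) ≤ ω + (2 * Real.pi * ‖η‖) ^ 2 := by
      have ha : m ≤ ω := min_le_left _ _
      have hb : m ≤ 1 := min_le_right _ _
      have hpi : 1 ≤ (2 * Real.pi) ^ 2 := by nlinarith [Real.pi_gt_three]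
      have hc : m * ‖η‖ ^ 2 ≤ (2 * Real.pi) ^ 2 * ‖η‖ ^ 2 :=
        mul_le_mul_of_nonneg_right (hb.trans hpi) (by positivity)
      rw [mul_pow]
      linarith
    have h2 : (1 + ‖η‖ ^ 2) ^ (-(4 : ℝ) / 2) = ((1 + ‖η‖ ^ 2)⁻¹) ^ 2 := by
      rw [show (-(4 : ℝ) / 2) = -((2 : ℕ) : ℝ) by norm_num, Real.rpow_neg (by positivity),
        Real.rpow_natCast, inv_pow]
    have hp := hpos η
    rw [h2, Real.norm_of_nonneg (by positivity), ← mul_pow, ← mul_inv]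
    gcongr
  exact hreal.ofReal

/-- The Green function `𝒢_ω(x) = (2π)⁻² ∫ e^{-i x·ξ} / (ω + |ξ|²) dξ` of `-Δ + ω` on `ℝ²`, as an
element of `L²(ℝ²)`. The integral does not converge absolutely and is meant as an `L²` Fourier
transform; Mathlib's `𝓕` has kernel `e^{-2πi x·η}`, and the change of variables `ξ = 2πη` absorbs
the factor `(2π)⁻²`. -/
def green {ω : ℝ} (hω : 0 < ω) : L2 :=
  𝓕 ((memLp_greenSymbol hω).toLp (greenSymbol ω))

/-- `β_α(ω) = α + γ/(2π) + (1/(2π)) ln(√ω / 2)`, with `γ` the Euler–Mascheroni constant. -/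
def beta (α ω : ℝ) : ℝ :=
  α + Real.eulerMascheroniConstant / (2 * Real.pi)
    + 1 / (2 * Real.pi) * Real.log (Real.sqrt ω / 2)

/-- `e_α = -4 e^{-2(2πα + γ)}`, the bottom of the spectrum of `-Δ_α`. -/
def bottom (α : ℝ) : ℝ :=
  -4 * Real.exp (-2 * (2 * Real.pi * α + Real.eulerMascheroniConstant))

/-- The graph of the point-perturbed Laplacian: `g ∈ 𝒟(-Δ_α)` and `-Δ_α g = h`, in the
representation with parameter `ω`. That is, `g = f + (f(0) / β_α(ω)) 𝒢_ω` with `f ∈ H²(ℝ²)`, and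
`(ω - Δ_α) g = (ω - Δ) f`. The value `f(0)` is that of the continuous representative `F` of `f`,
and `Δ f` is the distributional Laplacian. -/
def IsPointLaplacian (α : ℝ) {ω : ℝ} (hω : 0 < ω) (g h : L2) : Prop :=
  ∃ (f : L2) (F : Plane → ℂ),
    TemperedDistribution.MemSobolev 2 2 (Lp.toTemperedDistribution f) ∧
    Continuous F ∧ f =ᵐ[volume] F ∧
    g = f + (F 0 / (beta α ω : ℂ)) • green hω ∧
    Lp.toTemperedDistribution (h + (ω : ℂ) • g)
      = (ω : ℂ) • Lp.toTemperedDistribution f - Δ (Lp.toTemperedDistribution f)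

/-- The closure of the quadratic form `u ↦ ⟨-Δ_α u, u⟩`, `u ∈ 𝒟(-Δ_α)`: `g` belongs to the domain
of the closure, and `Q` is its value at `g`, if `g` is the `L²`-limit of a sequence `u n` in
`𝒟(-Δ_α)` that is Cauchy for the form and along which the form converges to `Q`.
(Mathlib's inner product is linear in the second entry; `v n = -Δ_α (u n)`.) -/
def IsClosedFormValue (α : ℝ) {ω : ℝ} (hω : 0 < ω) (g : L2) (Q : ℝ) : Prop :=
  ∃ u v : ℕ → L2,
    (∀ n, IsPointLaplacian α hω (u n) (v n)) ∧
    Tendsto u atTop (𝓝 g) ∧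
    Tendsto (fun k : ℕ × ℕ => (inner ℂ (u k.1 - u k.2) (v k.1 - v k.2)).re) atTop (𝓝 0) ∧
    Tendsto (fun n => (inner ℂ (u n) (v n)).re) atTop (𝓝 Q)

/-- The energy space `H¹_α(ℝ²)`: the form domain of `-Δ_α`. -/
def energySpace (α : ℝ) {ω : ℝ} (hω : 0 < ω) : Set L2 :=
  {g | ∃ Q, IsClosedFormValue α hω g Q}

open Classical in
/-- The quadratic form `(-Δ_α)[g]`, for `g` in the energy space. The form is closable, being that of
a lower semi-bounded symmetric operator, so the value does not depend on the sequence. -/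
def quadForm (α : ℝ) {ω : ℝ} (hω : 0 < ω) (g : L2) : ℝ :=
  if h : ∃ Q, IsClosedFormValue α hω g Q then h.choose else 0

/-- The energy norm, `‖g‖²_{H¹_α} = (-Δ_α)[g] + (1 - e_α) ‖g‖²_{L²}`. -/
def energyNorm (α : ℝ) {ω : ℝ} (hω : 0 < ω) (g : L2) : ℝ :=
  Real.sqrt (quadForm α hω g + (1 - bottom α) * ‖g‖ ^ 2)

end PointInteraction

end

/-! Write `w = κ + |2πη|²`. On the Fourier side an element `g` of the operator domain splits, for
every `κ > 0`, as `φ + c / w` with a charge `c` independent of `κ` and `∫ φ = c β_α(κ)`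
(`IsPointLaplacian.exists_charge`). This turns `⟨-Δ_α g, g⟩ + κ‖g‖²` into `E = ∫ w |φ|² + β_α(κ)
|c|²` (`form_add_eq`). Since `β_α` increases and is positive at `1 - e_α`, for `κ ≥ 1 - e_α` the
quantity `E` controls both `∫ w |φ|²` and `|c|²`.

The Green function just fails to lie in `H¹`, but it does lie in `H^(1-1/p)`, which still embeds
into `L^p`: in the plane order `1 - 2/p` suffices, and the surplus `1/p` becomes decay in `κ`. The
embedding `exists_eLpNorm_fourier_le` comes from a frequency cut-off depending on the level `t` of
the distribution function. The result is `‖g‖_p ≤ C κ^(-1/p) √E`, and a choice of `κ` depending on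
`g` yields the interpolated inequality. The parameter `ω` has disappeared by then, so `C` does not
depend on it. Fatou's lemma passes to the form domain. -/

noncomputable section

namespace PointInteraction

/-! ### `L^p` bounds for Fourier transforms by level-dependent frequency cut-off. -/

section FourierL2

variable {E : Type*} [NormedAddCommGroup E] [InnerProductSpace ℝ E] [FiniteDimensional ℝ E]
  [MeasurableSpace E] [BorelSpace E]

/-- The pairing of a Schwartz function with the Fourier integral of an integrable function. -/
theorem integral_fourier_schwartz_smul_eq (u : SchwartzMap E ℂ) {b : E → ℂ} (hb : Integrable b) :
    ∫ x, (𝓕 u) x • b x = ∫ x, u x • 𝓕 b x := by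
  simpa using! (VectorFourier.integral_fourierIntegral_smul_eq_flip (L := innerₗ E)
      Real.continuous_fourierChar continuous_inner u.integrable hb)

theorem continuous_fourier {b : E → ℂ} (hb : Integrable b) : Continuous (𝓕 b) :=
  VectorFourier.fourierIntegral_continuous Real.continuous_fourierChar
    (L := innerₗ E) continuous_inner hb

/-- On `L¹ ∩ L²` the `L²` Fourier transform is given by the Fourier integral. -/
theorem fourier_ae_eq_of_integrable (b : Lp ℂ 2 (volume : Measure E)) (hb : Integrable b) :
    (𝓕 b : Lp ℂ 2 (volume : Measure E)) =ᵐ[volume] 𝓕 (b : E → ℂ) := by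
  have hcont : Continuous (𝓕 (b : E → ℂ)) := continuous_fourier hb
  refine ae_eq_of_integral_contDiff_smul_eq
    ((Lp.memLp (𝓕 b)).locallyIntegrable (by norm_num)) hcont.locallyIntegrable ?_
  intro u hu hcs
  have hu1 : HasCompactSupport (Complex.ofRealCLM ∘ u) := hcs.comp_left rfl
  have hu2 : ContDiff ℝ (⊤ : ℕ∞) (Complex.ofRealCLM ∘ u) := by fun_prop
  set v := hu1.toSchwartzMap hu2
  have hv : ∀ x, v x = (u x : ℂ) := fun x => rfl
  have h1 := congrArg (fun S => S v) (Lp.fourier_toTemperedDistribution_eq b)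
  simp only [TemperedDistribution.fourier_apply, Lp.toTemperedDistribution_apply] at h1
  rw [integral_fourier_schwartz_smul_eq v hb] at h1
  simpa only [hv, Complex.coe_smul] using h1.symm

theorem norm_fourier_le {b : E → ℂ} (x : E) : ‖𝓕 b x‖ ≤ ∫ y, ‖b y‖ :=
  VectorFourier.norm_fourierIntegral_le_integral_norm _ _ (innerₗ E) b x

/-- Distribution function estimate for the Fourier transform: the part of `b` living on `S` has
a Fourier transform bounded by `t / 2`, the rest is estimated in `L²`. -/
theorem measure_lt_norm_fourier_le (b : Lp ℂ 2 (volume : Measure E)) {S : Set E}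
    (hS : MeasurableSet S) {t : ℝ} (ht : 0 < t) (hint : IntegrableOn b S)
    (hle : ∫ η in S, ‖b η‖ ≤ t / 2) :
    volume {x | t < ‖(𝓕 b : Lp ℂ 2 (volume : Measure E)) x‖}
      ≤ ENNReal.ofReal (4 / t ^ 2) * ∫⁻ η in Sᶜ, ‖b η‖ₑ ^ 2 := by
  have hm1 : MemLp (S.indicator b) 2 volume := (Lp.memLp b).indicator hS
  have hm2 : MemLp (Sᶜ.indicator b) 2 volume := (Lp.memLp b).indicator hS.compl
  set b1 : Lp ℂ 2 (volume : Measure E) := hm1.toLp _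
  set b2 : Lp ℂ 2 (volume : Measure E) := hm2.toLp _
  have hb1 : b1 =ᵐ[volume] S.indicator b := hm1.coeFn_toLp
  have hb2 : b2 =ᵐ[volume] Sᶜ.indicator b := hm2.coeFn_toLp
  have hsum : b = b1 + b2 := by
    refine Lp.ext ?_
    filter_upwards [hb1, hb2, Lp.coeFn_add b1 b2] with x h1 h2 h3
    rw [h3, Pi.add_apply, h1, h2, Set.indicator_self_add_compl_apply]
  have hi1 : Integrable b1 := ((integrable_indicator_iff hS).2 hint).congr hb1.symm
  have hbound : ∀ᵐ x, ‖(𝓕 b1 : Lp ℂ 2 (volume : Measure E)) x‖ ≤ t / 2 := by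
    filter_upwards [fourier_ae_eq_of_integrable b1 hi1] with x hx
    rw [hx]
    refine (norm_fourier_le x).trans (le_trans (le_of_eq ?_) hle)
    rw [← integral_indicator hS]
    refine integral_congr_ae ?_
    filter_upwards [hb1] with y hy
    rw [hy, norm_indicator_eq_indicator_norm]
  have hF : (𝓕 b : Lp ℂ 2 (volume : Measure E)) =ᵐ[volume]
      fun x => (𝓕 b1 : Lp ℂ 2 (volume : Measure E)) x + (𝓕 b2 : Lp ℂ 2 (volume : Measure E)) x := by
    rw [hsum, FourierTransform.fourier_add]
    exact Lp.coeFn_add _ _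
  have hsub : volume {x | t < ‖(𝓕 b : Lp ℂ 2 (volume : Measure E)) x‖}
      ≤ volume {x | ENNReal.ofReal (t / 2) ≤ ‖(𝓕 b2 : Lp ℂ 2 (volume : Measure E)) x‖ₑ} := by
    refine measure_mono_ae ?_
    filter_upwards [hbound, hF] with x h1 h2 (h3 : t < _)
    change ENNReal.ofReal (t / 2) ≤ _
    rw [← ofReal_norm]
    apply ENNReal.ofReal_le_ofReal
    rw [h2] at h3
    linarith [norm_add_le ((𝓕 b1 : Lp ℂ 2 (volume : Measure E)) x)
      ((𝓕 b2 : Lp ℂ 2 (volume : Measure E)) x)]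
  -- Chebyshev in `L²` at height `t / 2`, then Plancherel; `(t / 2)⁻²` is the constant `4 / t²`.
  have hch := mul_meas_ge_le_pow_eLpNorm' volume (p := 2) (by norm_num) (by norm_num)
    (Lp.aestronglyMeasurable (𝓕 b2)) (ENNReal.ofReal (t / 2))
  have hnorm : eLpNorm (𝓕 b2 : Lp ℂ 2 (volume : Measure E)) 2 volume
      = eLpNorm (Sᶜ.indicator b) 2 volume := by
    rw [← eLpNorm_congr_ae hb2,
      ← ENNReal.toReal_eq_toReal_iff' (Lp.eLpNorm_ne_top _) (Lp.eLpNorm_ne_top _),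
      ← Lp.norm_def, ← Lp.norm_def, Lp.norm_fourier_eq]
  have hval : eLpNorm (Sᶜ.indicator b) 2 volume ^ (2 : ℝ) = ∫⁻ η in Sᶜ, ‖b η‖ₑ ^ 2 := by
    rw [eLpNorm_indicator_eq_eLpNorm_restrict hS.compl,
      eLpNorm_eq_lintegral_rpow_enorm_toReal (by norm_num) (by norm_num), ← ENNReal.rpow_mul]
    simp
  simp only [ENNReal.toReal_ofNat] at hch
  rw [hnorm, hval] at hch
  refine hsub.trans ?_
  have ht2 : ENNReal.ofReal (t / 2) ^ (2 : ℝ) = ENNReal.ofReal (t ^ 2 / 4) := by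
    rw [ENNReal.ofReal_rpow_of_pos (by positivity)]
    congr 1
    norm_num
    ring
  rw [ht2] at hch
  have hone : ENNReal.ofReal (4 / t ^ 2) * ENNReal.ofReal (t ^ 2 / 4) = 1 := by
    rw [← ENNReal.ofReal_mul (by positivity)]
    field_simp
    simp
  calc volume {x | ENNReal.ofReal (t / 2) ≤ ‖(𝓕 b2 : Lp ℂ 2 (volume : Measure E)) x‖ₑ}
      = ENNReal.ofReal (4 / t ^ 2) * (ENNReal.ofReal (t ^ 2 / 4) *
        volume {x | ENNReal.ofReal (t / 2) ≤ ‖(𝓕 b2 : Lp ℂ 2 (volume : Measure E)) x‖ₑ}) := by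
        rw [← mul_assoc, hone, one_mul]
    _ ≤ _ := by gcongr

/-- An `L^p` bound for a Fourier transform, obtained by cutting the frequencies at each level `t`
of a function `T` for which the frequencies with `T ≤ t` contribute at most `t / 2`. -/
theorem lintegral_norm_fourier_rpow_le (b : Lp ℂ 2 (volume : Measure E)) {T : E → ℝ}
    (hT : Measurable T) (hT0 : ∀ η, 0 ≤ T η) {p : ℝ} (hp : 2 < p)
    (hint : ∀ t, 0 < t → IntegrableOn b {η | T η ≤ t})
    (hle : ∀ t, 0 < t → ∫ η in {η | T η ≤ t}, ‖b η‖ ≤ t / 2) :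
    ∫⁻ x, ENNReal.ofReal (‖(𝓕 b : Lp ℂ 2 (volume : Measure E)) x‖ ^ p)
      ≤ ENNReal.ofReal (4 * p / (p - 2)) * ∫⁻ η, ‖b η‖ₑ ^ 2 * ENNReal.ofReal (T η ^ (p - 2)) := by
  have hb : AEMeasurable (fun η => ‖b η‖ₑ ^ 2) volume :=
    ((Lp.aestronglyMeasurable b).enorm.pow_const 2)
  -- Layer cake on both sides: `T` with exponent `p - 2` under the measure `|b|² dη`, and `|𝓕 b|`
  -- with exponent `p` under Lebesgue measure. The factor `t⁻²` of the distribution estimate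
  -- accounts for the drop of the exponent by 2.
  have hcake := lintegral_rpow_eq_lintegral_meas_lt_mul
    (volume.withDensity fun η => ‖b η‖ₑ ^ 2) (Eventually.of_forall hT0) hT.aemeasurable
    (p := p - 2) (by linarith)
  rw [lintegral_withDensity_eq_lintegral_mul₀ hb (by fun_prop)] at hcake
  simp only [Pi.mul_apply] at hcake
  rw [hcake, lintegral_rpow_eq_lintegral_meas_lt_mul volume
    (Eventually.of_forall fun x => norm_nonneg _) (Lp.aestronglyMeasurable _).norm.aemeasurable
    (by linarith : 0 < p), ← mul_assoc, ← ENNReal.ofReal_mul (by apply div_nonneg <;> linarith),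
    show 4 * p / (p - 2) * (p - 2) = p * 4 by
      rw [div_mul_cancel₀ _ (by linarith : p - 2 ≠ 0)]; ring,
    ENNReal.ofReal_mul (by linarith), mul_assoc]
  gcongr
  rw [← lintegral_const_mul' _ _ ENNReal.ofReal_ne_top]
  refine setLIntegral_mono' measurableSet_Ioi fun t (ht : 0 < t) => ?_
  have hS : MeasurableSet {η | T η ≤ t} := hT measurableSet_Iic
  have hc : {η | T η ≤ t}ᶜ = {η | t < T η} := by ext; simp
  have hm := measure_lt_norm_fourier_le b hS ht (hint t ht) (hle t ht)
  rw [hc] at hm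
  have hS' : MeasurableSet {η | t < T η} := measurableSet_lt measurable_const hT
  rw [withDensity_apply _ hS']
  refine (mul_le_mul_left hm _).trans (le_of_eq ?_)
  rw [mul_assoc, mul_left_comm, mul_left_comm (ENNReal.ofReal 4),
    ← ENNReal.ofReal_mul (by positivity), ← ENNReal.ofReal_mul (by positivity)]
  congr 2
  rw [show p - 1 = (p - 2 - 1) + 2 by ring, Real.rpow_add ht, Real.rpow_two]
  field_simp

end FourierL2

/-! ### Radial integrals of the resolvent symbol. -/

/-- The symbol `κ + |2πη|²` of `κ - Δ`. -/
def resolventWeight (κ : ℝ) (η : Plane) : ℝ := κ + (2 * Real.pi * ‖η‖) ^ 2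

theorem le_resolventWeight (κ : ℝ) (η : Plane) : κ ≤ resolventWeight κ η := by
  unfold resolventWeight
  linarith [sq_nonneg (2 * Real.pi * ‖η‖)]

theorem resolventWeight_pos {κ : ℝ} (hκ : 0 < κ) (η : Plane) : 0 < resolventWeight κ η :=
  hκ.trans_le (le_resolventWeight κ η)

theorem continuous_resolventWeight (κ : ℝ) : Continuous (resolventWeight κ) := by
  unfold resolventWeight
  fun_prop

theorem greenSymbol_eq (κ : ℝ) (η : Plane) :
    greenSymbol κ η = (((resolventWeight κ η)⁻¹ : ℝ) : ℂ) := rfl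

/-- Integration of a nonnegative radial function on the plane by means of a primitive of
`y ↦ y * f y`. -/
theorem integral_radial_of_hasDerivAt {f G : ℝ → ℝ} {l : ℝ}
    (hG : ∀ y, 0 ≤ y → HasDerivAt G (y * f y) y) (hf : ∀ y, 0 < y → 0 ≤ f y)
    (hl : Tendsto G atTop (𝓝 l)) :
    Integrable (fun η : Plane => f ‖η‖) ∧
      ∫ η : Plane, f ‖η‖ = 2 * Real.pi * (l - G 0) := by
  have hpos : ∀ y ∈ Set.Ioi (0 : ℝ), 0 ≤ y * f y := fun y hy => mul_nonneg (le_of_lt hy) (hf y hy)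
  have hball : (volume : Measure Plane).real (Metric.ball 0 1) = Real.pi := by
    rw [Measure.real, EuclideanSpace.volume_ball_fin_two]
    simp [Real.pi_nonneg]
  constructor
  · rw [integrable_fun_norm_addHaar]
    simpa using integrableOn_Ioi_deriv_of_nonneg' (fun y hy => hG y hy) hpos hl
  · rw [integral_fun_norm_addHaar, hball]
    have := integral_Ioi_of_hasDerivAt_of_nonneg' (fun y hy => hG y hy) hpos hl
    simp only [finrank_euclideanSpace, Fintype.card_fin, Nat.add_one_sub_one, pow_one, smul_eq_mul,
      nsmul_eq_mul, Nat.cast_ofNat]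
    rw [this]
    ring

theorem hasDerivAt_add_sq (κ y : ℝ) :
    HasDerivAt (fun y : ℝ => κ + (2 * Real.pi * y) ^ 2) (8 * Real.pi ^ 2 * y) y := by
  have h := (((hasDerivAt_id y).const_mul (2 * Real.pi)).pow 2).const_add κ
  refine h.congr_deriv ?_
  simp
  ring

theorem tendsto_add_sq_atTop (κ : ℝ) :
    Tendsto (fun y : ℝ => κ + (2 * Real.pi * y) ^ 2) atTop atTop :=
  tendsto_atTop_add_const_left _ _ ((tendsto_pow_atTop two_ne_zero).comp
    (tendsto_id.const_mul_atTop (by positivity)))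

/-- `∫ (κ + |2πη|²)^(-s) dη = κ^(1-s) / (4π(s-1))` for `s > 1`. -/
theorem integral_resolventWeight_rpow {κ s : ℝ} (hκ : 0 < κ) (hs : 1 < s) :
    Integrable (fun η => resolventWeight κ η ^ (-s)) ∧
      ∫ η, resolventWeight κ η ^ (-s) = κ ^ (1 - s) / (4 * Real.pi * (s - 1)) := by
  have hpos : ∀ y : ℝ, 0 < κ + (2 * Real.pi * y) ^ 2 := fun y => by positivity
  have hs1 : 1 - s ≠ 0 := by linarith
  have hs2 : s - 1 ≠ 0 := by linarith
  have hpi := Real.pi_pos.ne'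
  have := integral_radial_of_hasDerivAt (f := fun y => (κ + (2 * Real.pi * y) ^ 2) ^ (-s))
    (G := fun y => (κ + (2 * Real.pi * y) ^ 2) ^ (1 - s) / (8 * Real.pi ^ 2 * (1 - s))) (l := 0)
    (fun y _ => by
      have h := ((hasDerivAt_add_sq κ y).rpow_const (p := 1 - s) (Or.inl (hpos y).ne')).div_const
        (8 * Real.pi ^ 2 * (1 - s))
      refine h.congr_deriv ?_
      rw [show 1 - s - 1 = -s by ring]
      field_simp)
    (fun y _ => (Real.rpow_pos_of_pos (hpos y) _).le)
    (by
      have h := ((tendsto_rpow_neg_atTop (y := s - 1) (by linarith)).comp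
        (tendsto_add_sq_atTop κ)).div_const (8 * Real.pi ^ 2 * (1 - s))
      simpa using h)
  refine ⟨this.1, this.2.trans ?_⟩
  simp only [mul_zero, ne_eq, OfNat.ofNat_ne_zero, not_false_eq_true, zero_pow, add_zero]
  rw [show 8 * Real.pi ^ 2 * (1 - s) = -(8 * Real.pi ^ 2 * (s - 1)) by ring]
  field_simp
  ring

/-- Neither inverse is integrable alone, but the logarithmic primitives cancel at infinity and only
the value at the origin remains. The order `ω ≤ κ` gives the sign required by
`integral_radial_of_hasDerivAt`. -/
theorem integral_inv_sub_inv_of_le {ω κ : ℝ} (hω : 0 < ω) (h : ω ≤ κ) :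
    Integrable (fun η => (resolventWeight ω η)⁻¹ - (resolventWeight κ η)⁻¹) ∧
      ∫ η, ((resolventWeight ω η)⁻¹ - (resolventWeight κ η)⁻¹)
        = (Real.log κ - Real.log ω) / (4 * Real.pi) := by
  have hκ : 0 < κ := hω.trans_le h
  have hposω : ∀ y : ℝ, 0 < ω + (2 * Real.pi * y) ^ 2 := fun y => by positivity
  have hposκ : ∀ y : ℝ, 0 < κ + (2 * Real.pi * y) ^ 2 := fun y => by positivity
  have hpi := Real.pi_pos.ne'
  have := integral_radial_of_hasDerivAt
    (f := fun y => (ω + (2 * Real.pi * y) ^ 2)⁻¹ - (κ + (2 * Real.pi * y) ^ 2)⁻¹)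
    (G := fun y => (Real.log (ω + (2 * Real.pi * y) ^ 2) - Real.log (κ + (2 * Real.pi * y) ^ 2))
      / (8 * Real.pi ^ 2)) (l := 0)
    (fun y _ => by
      have h := (((hasDerivAt_add_sq ω y).log (hposω y).ne').sub
        ((hasDerivAt_add_sq κ y).log (hposκ y).ne')).div_const (8 * Real.pi ^ 2)
      refine h.congr_deriv ?_
      have h1 := (hposω y).ne'
      have h2 := (hposκ y).ne'
      field_simp)
    (fun y _ => sub_nonneg.2 (inv_anti₀ (hposω y) (by linarith)))
    (by
      have h1 : Tendsto (fun y : ℝ => 1 + (ω - κ) * (κ + (2 * Real.pi * y) ^ 2)⁻¹) atTop (𝓝 1) := by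
        simpa using ((tendsto_inv_atTop_zero.comp
          (tendsto_add_sq_atTop κ)).const_mul (ω - κ)).const_add 1
      have h2 := ((Real.continuousAt_log one_ne_zero).tendsto.comp h1).div_const (8 * Real.pi ^ 2)
      rw [Real.log_one, zero_div] at h2
      refine h2.congr fun y => ?_
      rw [Function.comp_apply, ← Real.log_div (hposω y).ne' (hposκ y).ne']
      congr 2
      have h2 := (hposκ y).ne'
      field_simp
      ring)
  refine ⟨this.1, this.2.trans ?_⟩
  simp only [mul_zero, ne_eq, OfNat.ofNat_ne_zero, not_false_eq_true, zero_pow, add_zero]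
  field_simp
  ring

/-- `∫ (1/(ω + |2πη|²) - 1/(κ + |2πη|²)) dη = ln(κ/ω) / (4π)`. -/
theorem integral_inv_sub_inv {ω κ : ℝ} (hω : 0 < ω) (hκ : 0 < κ) :
    Integrable (fun η => (resolventWeight ω η)⁻¹ - (resolventWeight κ η)⁻¹) ∧
      ∫ η, ((resolventWeight ω η)⁻¹ - (resolventWeight κ η)⁻¹)
        = (Real.log κ - Real.log ω) / (4 * Real.pi) := by
  rcases le_total ω κ with h | h
  · exact integral_inv_sub_inv_of_le hω h
  · obtain ⟨h1, h2⟩ := integral_inv_sub_inv_of_le hκ h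
    have e : (fun η => (resolventWeight ω η)⁻¹ - (resolventWeight κ η)⁻¹)
        = fun η => -((resolventWeight κ η)⁻¹ - (resolventWeight ω η)⁻¹) := by
      ext; ring
    rw [e]
    refine ⟨h1.neg, ?_⟩
    rw [integral_neg, h2]
    ring

/-! ### The coupling function `β_α`. -/

/-- The constants `γ` and `ln 2` are absorbed into `-e_α`. In this form the zero at `-e_α` and the
monotonicity are visible, and `β_α(κ) - β_α(ω)` is the integral in `integral_inv_sub_inv`. -/
theorem beta_eq (α : ℝ) {ω : ℝ} (hω : 0 < ω) :
    beta α ω = (Real.log ω - Real.log (-bottom α)) / (4 * Real.pi) := by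
  have hb : Real.log (-bottom α)
      = 2 * Real.log 2 - 2 * (2 * Real.pi * α + Real.eulerMascheroniConstant) := by
    rw [bottom, neg_mul, neg_neg, Real.log_mul (by norm_num) (Real.exp_pos _).ne', Real.log_exp,
      show (4 : ℝ) = 2 ^ 2 by norm_num, Real.log_pow]
    push_cast
    ring
  rw [hb, beta, Real.log_div (Real.sqrt_pos.2 hω).ne' two_ne_zero, Real.log_sqrt hω.le]
  have := Real.pi_pos.ne'
  field_simp
  ring

theorem bottom_neg (α : ℝ) : bottom α < 0 := by
  unfold bottom
  linarith [Real.exp_pos (-2 * (2 * Real.pi * α + Real.eulerMascheroniConstant))]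

theorem beta_ne_zero {α ω : ℝ} (hω : 0 < ω) (h : ω ≠ -bottom α) : beta α ω ≠ 0 := by
  rw [beta_eq α hω]
  have hb := bottom_neg α
  refine div_ne_zero (sub_ne_zero.2 fun e => h ?_) (by positivity)
  exact Real.log_injOn_pos hω (show 0 < -bottom α by linarith) e

theorem beta_mono {α ω κ : ℝ} (hω : 0 < ω) (h : ω ≤ κ) : beta α ω ≤ beta α κ := by
  rw [beta_eq α hω, beta_eq α (hω.trans_le h)]
  have := Real.log_le_log hω h
  gcongr

theorem beta_one_sub_bottom_pos (α : ℝ) : 0 < beta α (1 - bottom α) := by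
  have hb := bottom_neg α
  rw [beta_eq α (by linarith)]
  exact div_pos (sub_pos.2 (Real.log_lt_log (by linarith) (by linarith))) (by positivity)

/-! ### The operator and its form on the Fourier side. -/

theorem toTemperedDistribution_apply_fourierInv (f : L2) (u : SchwartzMap Plane ℂ) :
    Lp.toTemperedDistribution f (𝓕⁻ u) = ∫ η, u η • (𝓕⁻ f : L2) η := by
  rw [← TemperedDistribution.fourierInv_apply, Lp.fourierInv_toTemperedDistribution_eq,
    Lp.toTemperedDistribution_apply]

theorem fourier_laplacian_fourierInv (u : SchwartzMap Plane ℂ) (η : Plane) :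
    𝓕 (Δ (𝓕⁻ u)) η = -(((2 * Real.pi * ‖η‖) ^ 2 : ℝ) : ℂ) * u η := by
  rw [SchwartzMap.laplacian_eq_fourierMultiplierCLM, SchwartzMap.fourierMultiplierCLM_apply,
    FourierTransform.fourier_fourierInv_eq, ← Complex.coe_smul, FourierTransform.fourier_smul,
    FourierTransform.fourier_fourierInv_eq, smul_apply,
    SchwartzMap.smulLeftCLM_apply_apply (by fun_prop)]
  simp
  ring

/-- The equation `v = (ω - Δ) f` on the Fourier side. -/
theorem fourierInv_eq_resolventWeight_mul {ω : ℝ} {f v : L2}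
    (h : Lp.toTemperedDistribution v
      = (ω : ℂ) • Lp.toTemperedDistribution f - Δ (Lp.toTemperedDistribution f)) :
    ∀ᵐ η, (𝓕⁻ v : L2) η = (resolventWeight ω η : ℂ) * (𝓕⁻ f : L2) η := by
  have hlv : LocallyIntegrable (𝓕⁻ v : L2) volume :=
    (Lp.memLp (𝓕⁻ v : L2)).locallyIntegrable (by norm_num)
  have hlf : LocallyIntegrable (𝓕⁻ f : L2) volume :=
    (Lp.memLp (𝓕⁻ f : L2)).locallyIntegrable (by norm_num)
  have hw : Continuous fun η => (resolventWeight ω η : ℂ) :=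
    Complex.continuous_ofReal.comp (continuous_resolventWeight ω)
  have hlw : LocallyIntegrable (fun η => (resolventWeight ω η : ℂ) * (𝓕⁻ f : L2) η) volume := by
    rw [← locallyIntegrableOn_univ] at hlf ⊢
    exact hlf.continuousOn_mul hw.continuousOn isOpen_univ.isLocallyClosed
  refine ae_eq_of_integral_contDiff_smul_eq hlv hlw ?_
  intro u hu hcs
  have hu1 : HasCompactSupport (Complex.ofRealCLM ∘ u) := hcs.comp_left rfl
  have hu2 : ContDiff ℝ (⊤ : ℕ∞) (Complex.ofRealCLM ∘ u) := by fun_prop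
  set U := hu1.toSchwartzMap hu2
  have hU : ∀ x, U x = (u x : ℂ) := fun x => rfl
  have h1 := congrArg (fun S => S (𝓕⁻ U)) h
  have h2 : (Δ (Lp.toTemperedDistribution f)) (𝓕⁻ U)
      = ∫ η, (𝓕 (Δ (𝓕⁻ U))) η • (𝓕⁻ f : L2) η := by
    rw [TemperedDistribution.laplacian_apply_apply, ← toTemperedDistribution_apply_fourierInv,
      FourierTransform.fourierInv_fourier_eq]
  simp only [sub_apply, smul_apply, h2,
    toTemperedDistribution_apply_fourierInv] at h1
  have hi : Integrable (fun η => U η • (𝓕⁻ f : L2) η) := by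
    simpa only [hU, Complex.coe_smul] using
      hlf.integrable_smul_left_of_hasCompactSupport hu.continuous hcs
  have hi2 : Integrable (fun η => (𝓕 (Δ (𝓕⁻ U))) η • (𝓕⁻ f : L2) η) := by
    have hm : Continuous fun η : Plane => -(2 * Real.pi * ‖η‖) ^ 2 * u η := by
      have := hu.continuous
      fun_prop
    have := hlf.integrable_smul_left_of_hasCompactSupport hm hcs.mul_left
    refine this.congr (Eventually.of_forall fun η => ?_)
    simp only [fourier_laplacian_fourierInv, hU, smul_eq_mul, Complex.real_smul]
    push_cast
    ring
  have hi3 : Integrable (fun η => (ω : ℂ) • U η • (𝓕⁻ f : L2) η) :=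
    hi.smul (ω : ℂ)
  rw [← integral_smul, ← integral_sub hi3 hi2] at h1
  simp only [← Complex.coe_smul, ← hU]
  rw [h1]
  congr 1
  ext η
  simp only [fourier_laplacian_fourierInv, smul_eq_mul, resolventWeight]
  push_cast
  ring

/-- The spectral description of `-Δ_α`: on the Fourier side `g` has the singular part
`c / (κ + |2πη|²)`, for every `κ > 0`, and the integral of the remainder is `c β_α(κ)`. -/
theorem IsPointLaplacian.exists_charge {α ω : ℝ} {hω : 0 < ω} (hne : ω ≠ -bottom α) {g h : L2}
    (hgh : IsPointLaplacian α hω g h) :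
    ∃ c : ℂ, ∀ κ : ℝ, 0 < κ →
      (∀ᵐ η, (𝓕⁻ h : L2) η + κ * (𝓕⁻ g : L2) η
        = resolventWeight κ η * ((𝓕⁻ g : L2) η - c * greenSymbol κ η)) ∧
      Integrable (fun η => (𝓕⁻ g : L2) η - c * greenSymbol κ η) ∧
      ∫ η, ((𝓕⁻ g : L2) η - c * greenSymbol κ η) = c * beta α κ := by
  obtain ⟨f, F, -, hF, hfF, hg, heq⟩ := hgh
  set c : ℂ := F 0 / (beta α ω : ℂ) with hc
  have hwne : ∀ {κ : ℝ}, 0 < κ → ∀ η, (resolventWeight κ η : ℂ) ≠ 0 := fun hκ η =>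
    Complex.ofReal_ne_zero.2 (resolventWeight_pos hκ η).ne'
  have hv := fourierInv_eq_resolventWeight_mul heq
  have hgF : ∀ᵐ η, (𝓕⁻ g : L2) η = (𝓕⁻ f : L2) η + c * greenSymbol ω η := by
    have e : (𝓕⁻ g : L2) = 𝓕⁻ f + c • (memLp_greenSymbol hω).toLp (greenSymbol ω) := by
      rw [hg, FourierTransform.fourierInv_add, FourierTransform.fourierInv_smul, green,
        FourierTransform.fourierInv_fourier_eq]
    rw [e]
    filter_upwards [Lp.coeFn_add (𝓕⁻ f : L2) (c • (memLp_greenSymbol hω).toLp (greenSymbol ω)),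
      Lp.coeFn_smul c ((memLp_greenSymbol hω).toLp (greenSymbol ω)),
      (memLp_greenSymbol hω).coeFn_toLp] with η h1 h2 h3
    rw [h1, Pi.add_apply, h2, Pi.smul_apply, h3, smul_eq_mul]
  have hvF : ∀ᵐ η, (𝓕⁻ (h + (ω : ℂ) • g) : L2) η = (𝓕⁻ h : L2) η + ω * (𝓕⁻ g : L2) η := by
    rw [FourierTransform.fourierInv_add, FourierTransform.fourierInv_smul]
    filter_upwards [Lp.coeFn_add (𝓕⁻ h : L2) ((ω : ℂ) • (𝓕⁻ g : L2)),
      Lp.coeFn_smul (ω : ℂ) (𝓕⁻ g : L2)] with η h1 h2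
    rw [h1, Pi.add_apply, h2, Pi.smul_apply, smul_eq_mul]
  -- `𝓕⁻ f` is the product of the Green symbol and the `L²` function `𝓕⁻ (h + ω g)`, hence
  -- integrable; this gives the point value `F 0` as an integral.
  have hfi : Integrable (𝓕⁻ f : L2) := by
    refine ((memLp_greenSymbol hω).integrable_mul
      (Lp.memLp (𝓕⁻ (h + (ω : ℂ) • g) : L2))).congr ?_
    filter_upwards [hv] with η h1
    have := hwne hω η
    rw [Pi.mul_apply, h1, greenSymbol_eq]
    push_cast
    field_simp
  have hF0 : F 0 = ∫ η, (𝓕⁻ f : L2) η := by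
    have h1 := fourier_ae_eq_of_integrable (𝓕⁻ f : L2) hfi
    rw [FourierTransform.fourier_fourierInv_eq] at h1
    have h2 : F = 𝓕 ((𝓕⁻ f : L2) : Plane → ℂ) :=
      (hF.ae_eq_iff_eq volume (continuous_fourier hfi)).1 (hfF.symm.trans h1)
    rw [h2, Real.fourier_eq]
    simp
  refine ⟨c, fun κ hκ => ⟨?_, ?_⟩⟩
  · filter_upwards [hv, hgF, hvF] with η h1 h2 h3
    have e1 := hwne hω η
    have e2 := hwne hκ η
    have e3 : (𝓕⁻ h : L2) η = resolventWeight ω η * (𝓕⁻ f : L2) η - ω * (𝓕⁻ g : L2) η := by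
      rw [← h1, h3]
      ring
    rw [e3, h2, greenSymbol_eq, greenSymbol_eq]
    push_cast
    field_simp
    simp only [resolventWeight]
    push_cast
    ring
  -- Replacing `ω` by `κ` in the singular part adds `c (β_α(κ) - β_α(ω))` to the integral `F 0 = c
  -- β_α(ω)`.
  · obtain ⟨h1, h2⟩ := integral_inv_sub_inv hω hκ
    have h1c : Integrable
        (fun η => c * (((resolventWeight ω η)⁻¹ - (resolventWeight κ η)⁻¹ : ℝ) : ℂ)) :=
      h1.ofReal.const_mul c
    have hi : Integrable (fun η => (𝓕⁻ f : L2) η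
        + c * (((resolventWeight ω η)⁻¹ - (resolventWeight κ η)⁻¹ : ℝ) : ℂ)) :=
      hfi.add h1c
    have hae : (fun η => (𝓕⁻ f : L2) η
        + c * (((resolventWeight ω η)⁻¹ - (resolventWeight κ η)⁻¹ : ℝ) : ℂ)) =ᵐ[volume]
        fun η => (𝓕⁻ g : L2) η - c * greenSymbol κ η := by
      filter_upwards [hgF] with η h3
      rw [h3, greenSymbol_eq, greenSymbol_eq]
      push_cast
      ring
    refine ⟨hi.congr hae, ?_⟩
    rw [← integral_congr_ae hae, integral_add hfi h1c, integral_const_mul,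
      integral_complex_ofReal, h2, ← hF0]
    have hb : (beta α ω : ℂ) ≠ 0 := Complex.ofReal_ne_zero.2 (beta_ne_zero hω hne)
    have e : F 0 = c * beta α ω := by rw [hc, div_mul_cancel₀ _ hb]
    rw [e, ← mul_add, ← Complex.ofReal_add, beta_eq α hω, beta_eq α hκ]
    congr 2
    ring

/-- The form of `-Δ_α` shifted by `κ`, in terms of the regular part `φ = ĝ - c / (κ + |2πη|²)` and
the charge `c`. -/
theorem form_add_eq {α κ : ℝ} (hκ : 0 < κ) {g h : L2} {c : ℂ}
    (hae : ∀ᵐ η, (𝓕⁻ h : L2) η + κ * (𝓕⁻ g : L2) η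
        = resolventWeight κ η * ((𝓕⁻ g : L2) η - c * greenSymbol κ η))
    (hint : Integrable (fun η => (𝓕⁻ g : L2) η - c * greenSymbol κ η))
    (hval : ∫ η, ((𝓕⁻ g : L2) η - c * greenSymbol κ η) = c * beta α κ) :
    Integrable (fun η => resolventWeight κ η * ‖(𝓕⁻ g : L2) η - c * greenSymbol κ η‖ ^ 2) ∧
      (inner ℂ g h).re + κ * ‖g‖ ^ 2
        = (∫ η, resolventWeight κ η * ‖(𝓕⁻ g : L2) η - c * greenSymbol κ η‖ ^ 2)
          + beta α κ * ‖c‖ ^ 2 := by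
  set b : L2 := 𝓕⁻ g with hb
  set k : L2 := 𝓕⁻ h with hk
  have hgb : g = 𝓕 b := (FourierTransform.fourier_fourierInv_eq g).symm
  have hhk : h = 𝓕 k := (FourierTransform.fourier_fourierInv_eq h).symm
  have hq : ∀ᵐ η, (k + (κ : ℂ) • b : L2) η
      = resolventWeight κ η * (b η - c * greenSymbol κ η) := by
    filter_upwards [hae, Lp.coeFn_add k ((κ : ℂ) • b), Lp.coeFn_smul (κ : ℂ) b] with η h1 h2 h3
    rw [h2, Pi.add_apply, h3, Pi.smul_apply, smul_eq_mul, h1]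
  -- With `b = φ + c G` and `w G = 1`, pairing `b` with `w φ` leaves `w |φ|²` plus `conj c * φ`,
  -- whose integral is `β_α(κ) |c|²`.
  have hpt : ∀ᵐ η, inner ℂ (b η) ((k + (κ : ℂ) • b : L2) η)
      = ((resolventWeight κ η * ‖b η - c * greenSymbol κ η‖ ^ 2 : ℝ) : ℂ)
        + starRingEnd ℂ c * (b η - c * greenSymbol κ η) := by
    filter_upwards [hq] with η h1
    have hw : (resolventWeight κ η : ℂ) ≠ 0 :=
      Complex.ofReal_ne_zero.2 (resolventWeight_pos hκ η).ne'
    have hG : (resolventWeight κ η : ℂ) * greenSymbol κ η = 1 := by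
      rw [greenSymbol_eq, Complex.ofReal_inv, mul_inv_cancel₀ hw]
    have hGs : starRingEnd ℂ (greenSymbol κ η) = greenSymbol κ η := by
      rw [greenSymbol_eq, Complex.conj_ofReal]
    rw [h1, RCLike.inner_apply]
    push_cast
    rw [← Complex.mul_conj', map_sub, map_mul, hGs]
    linear_combination
      (starRingEnd ℂ c * (b η - c * greenSymbol κ η)) * hG
  have hii : Integrable (fun η => inner ℂ (b η) ((k + (κ : ℂ) • b : L2) η)) :=
    L2.integrable_inner b _
  have hci : Integrable (fun η => starRingEnd ℂ c * (b η - c * greenSymbol κ η)) :=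
    hint.const_mul _
  have hwC : Integrable
      (fun η => ((resolventWeight κ η * ‖b η - c * greenSymbol κ η‖ ^ 2 : ℝ) : ℂ)) := by
    refine (hii.sub hci).congr ?_
    filter_upwards [hpt] with η h1
    rw [Pi.sub_apply, h1]
    ring
  have hw : Integrable (fun η => resolventWeight κ η * ‖b η - c * greenSymbol κ η‖ ^ 2) := by
    simpa only [RCLike.re_to_complex, Complex.ofReal_re] using hwC.re
  refine ⟨hw, ?_⟩
  have h1 : inner ℂ b (k + (κ : ℂ) • b)
      = ((∫ η, resolventWeight κ η * ‖b η - c * greenSymbol κ η‖ ^ 2 : ℝ) : ℂ)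
        + starRingEnd ℂ c * (c * beta α κ) := by
    rw [L2.inner_def, integral_congr_ae hpt, integral_add hwC hci, integral_complex_ofReal,
      integral_const_mul, hval]
  rw [inner_add_right, inner_smul_right, inner_self_eq_norm_sq_to_K] at h1
  have h2 : (inner ℂ g h).re = (inner ℂ b k).re := by
    rw [hgb, hhk, Lp.inner_fourier_eq]
  have h3 : ‖g‖ = ‖b‖ := by rw [hgb, Lp.norm_fourier_eq]
  rw [h2, h3]
  have h4 : starRingEnd ℂ c * (c * beta α κ) = ((beta α κ * ‖c‖ ^ 2 : ℝ) : ℂ) := by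
    push_cast
    rw [← Complex.mul_conj']
    ring
  rw [h4] at h1
  have h5 := congrArg Complex.re h1
  simpa [← Complex.ofReal_pow] using h5

/-! ### A Sobolev inequality with parameter `κ`. -/

/-- The frequencies with `κ + |2πη|² ≤ R` contribute `O(R^(1/p))` to the Fourier transform of a
function that is square-integrable against the weight `(κ + |2πη|²)^(1-1/p)`. -/
theorem setIntegral_norm_le {p κ B R : ℝ} (hp : 0 < p) (hκ : 0 < κ) (hR : 0 < R) (b : L2)
    (hint : Integrable (fun η => resolventWeight κ η ^ (1 - 1 / p) * ‖b η‖ ^ 2))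
    (hB : ∫ η, resolventWeight κ η ^ (1 - 1 / p) * ‖b η‖ ^ 2 ≤ B) :
    IntegrableOn b {η | resolventWeight κ η ≤ R} ∧
      ∫ η in {η | resolventWeight κ η ≤ R}, ‖b η‖
        ≤ R ^ (1 / p) * √(B * (p / (4 * Real.pi) * κ ^ (-(1 / p)))) := by
  set w := resolventWeight κ with hw
  have hwpos : ∀ η, 0 < w η := resolventWeight_pos hκ
  have hwc : Continuous w := continuous_resolventWeight κ
  have hwr : ∀ r : ℝ, Continuous fun η => w η ^ r := fun r =>
    hwc.rpow_const fun η => Or.inl (hwpos η).ne'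
  have hS : MeasurableSet {η | w η ≤ R} := measurableSet_le hwc.measurable measurable_const
  obtain ⟨hi2, hv2⟩ := integral_resolventWeight_rpow hκ (s := 1 + 1 / p) (by simpa using hp)
  -- Cauchy–Schwarz for `‖b‖ = w^(1/p) u v`: the first factor is at most `R^(1/p)` on the low
  -- frequencies, and `v²` is integrable because `1 + 1/p > 1`.
  set u : Plane → ℝ := fun η => w η ^ ((1 - 1 / p) / 2) * ‖b η‖ with hu
  set v : Plane → ℝ := fun η => w η ^ (-(1 + 1 / p) / 2) with hv
  have hu0 : ∀ η, 0 ≤ u η := fun η => mul_nonneg (Real.rpow_nonneg (hwpos η).le _) (norm_nonneg _)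
  have hv0 : ∀ η, 0 ≤ v η := fun η => Real.rpow_nonneg (hwpos η).le _
  have husq : ∀ η, u η ^ 2 = w η ^ (1 - 1 / p) * ‖b η‖ ^ 2 := fun η => by
    rw [hu, mul_pow, ← Real.rpow_mul_natCast (hwpos η).le]
    congr 2
    push_cast
    ring
  have hvsq : ∀ η, v η ^ 2 = w η ^ (-(1 + 1 / p)) := fun η => by
    rw [hv, ← Real.rpow_mul_natCast (hwpos η).le]
    congr 1
    push_cast
    ring
  have hum : AEStronglyMeasurable u volume :=
    (hwr _).aestronglyMeasurable.mul (Lp.aestronglyMeasurable b).norm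
  have hvm : AEStronglyMeasurable v volume := (hwr _).aestronglyMeasurable
  have huL : MemLp u 2 volume := by
    rw [memLp_two_iff_integrable_sq hum]
    exact hint.congr (Eventually.of_forall fun η => (husq η).symm)
  have hvL : MemLp v 2 volume := by
    rw [memLp_two_iff_integrable_sq hvm]
    exact hi2.congr (Eventually.of_forall fun η => (hvsq η).symm)
  have huv : Integrable (fun η => R ^ (1 / p) * (u η * v η)) :=
    (huL.integrable_mul hvL).const_mul _
  have hle : ∀ η ∈ {η | w η ≤ R}, ‖b η‖ ≤ R ^ (1 / p) * (u η * v η) := by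
    intro η (hη : w η ≤ R)
    have h1 : u η * v η = w η ^ (-(1 / p)) * ‖b η‖ := by
      rw [hu, hv]
      dsimp only
      rw [mul_right_comm, ← Real.rpow_add (hwpos η)]
      congr 2
      ring
    rw [h1, ← mul_assoc]
    refine le_mul_of_one_le_left (norm_nonneg _) ?_
    rw [Real.rpow_neg (hwpos η).le, ← div_eq_mul_inv, one_le_div (Real.rpow_pos_of_pos (hwpos η) _)]
    exact Real.rpow_le_rpow (hwpos η).le hη (by positivity)
  have hbi : IntegrableOn b {η | w η ≤ R} := by
    refine (huv.integrableOn (s := {η | w η ≤ R})).mono'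
      (Lp.aestronglyMeasurable b).restrict ?_
    exact (ae_restrict_iff' hS).2 (Eventually.of_forall hle)
  refine ⟨hbi, ?_⟩
  have hCS := integral_mul_le_Lp_mul_Lq_of_nonneg (μ := volume) Real.HolderConjugate.two_two
    (Eventually.of_forall hu0) (Eventually.of_forall hv0) (by simpa using huL) (by simpa using hvL)
  simp only [Real.rpow_two, husq, hvsq, ← Real.sqrt_eq_rpow] at hCS
  calc ∫ η in {η | w η ≤ R}, ‖b η‖
      ≤ ∫ η in {η | w η ≤ R}, R ^ (1 / p) * (u η * v η) :=
        setIntegral_mono_on hbi.norm huv.integrableOn hS hle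
    _ ≤ ∫ η, R ^ (1 / p) * (u η * v η) :=
        setIntegral_le_integral huv (Eventually.of_forall fun η =>
          mul_nonneg (Real.rpow_nonneg hR.le _) (mul_nonneg (hu0 η) (hv0 η)))
    _ = R ^ (1 / p) * ∫ η, u η * v η := integral_const_mul _ _
    _ ≤ R ^ (1 / p) * (√B * √(∫ η, w η ^ (-(1 + 1 / p)))) := by
        gcongr
        exact hCS.trans (by gcongr)
    _ = _ := by
        rw [hv2, ← Real.sqrt_mul ((integral_nonneg fun η => by
          have := hwpos η; positivity).trans hB)]
        congr 3
        rw [show 1 - (1 + 1 / p) = -(1 / p) by ring, show 1 + 1 / p - 1 = 1 / p by ring]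
        field_simp

/-- A Sobolev inequality with a parameter: `L^p` is controlled by the weight
`(κ + |2πη|²)^(1-1/p)` on the Fourier side. -/
theorem exists_eLpNorm_fourier_le {p : ℝ} (hp : 2 < p) :
    ∃ C : ℝ, 0 < C ∧ ∀ (κ : ℝ), 0 < κ → ∀ (B : ℝ), 0 < B → ∀ b : L2,
      Integrable (fun η => resolventWeight κ η ^ (1 - 1 / p) * ‖b η‖ ^ 2) →
      ∫ η, resolventWeight κ η ^ (1 - 1 / p) * ‖b η‖ ^ 2 ≤ B →
      eLpNorm (𝓕 b : L2) (ENNReal.ofReal p) volume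
        ≤ ENNReal.ofReal (C * √(B * κ ^ (-(1 / p)))) := by
  have hp0 : 0 < p := by linarith
  have hp2 : 0 < p - 2 := by linarith
  set K : ℝ := p / (4 * Real.pi) with hK
  have hK0 : 0 < K := by positivity
  set C0 : ℝ := 4 * p / (p - 2) * (2 * √K) ^ (p - 2) with hC0
  have hC0pos : 0 < C0 := by positivity
  refine ⟨C0 ^ (1 / p), by positivity, fun κ hκ B hB b hint hle => ?_⟩
  set w := resolventWeight κ with hw
  have hwpos : ∀ η, 0 < w η := resolventWeight_pos hκ
  have hwc : Continuous w := continuous_resolventWeight κ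
  set D : ℝ := B * κ ^ (-(1 / p)) with hD
  have hD0 : 0 < D := by positivity
  -- Chosen so that the frequencies with `A w^(1/p) ≤ t`, that is `w ≤ (t / A)^p`, contribute at
  -- most `(t / A) √(K D) = t / 2`.
  set A : ℝ := 2 * √K * √D with hA
  have hA0 : 0 < A := by positivity
  have hlow : ∀ t, 0 < t → IntegrableOn b {η | A * w η ^ (1 / p) ≤ t} ∧
      ∫ η in {η | A * w η ^ (1 / p) ≤ t}, ‖b η‖ ≤ t / 2 := by
    intro t ht
    have hset : {η | A * w η ^ (1 / p) ≤ t} = {η | w η ≤ (t / A) ^ p} := by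
      ext η
      simp only [Set.mem_ofPred_eq]
      rw [mul_comm, ← le_div_iff₀ hA0, one_div,
        Real.rpow_inv_le_iff_of_pos (hwpos η).le (by positivity) hp0]
    obtain ⟨h1, h2⟩ := setIntegral_norm_le hp0 hκ (R := (t / A) ^ p) (by positivity) b hint hle
    rw [hset]
    refine ⟨h1, h2.trans (le_of_eq ?_)⟩
    rw [← Real.rpow_mul (by positivity), mul_one_div_cancel hp0.ne', Real.rpow_one,
      show B * (p / (4 * Real.pi) * κ ^ (-(1 / p))) = K * D by rw [hD, hK]; ring,
      Real.sqrt_mul hK0.le, hA]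
    have h3 : √K ≠ 0 := by positivity
    have h4 : √D ≠ 0 := by positivity
    field_simp
  have hTm : Measurable fun η => A * w η ^ (1 / p) :=
    (continuous_const.mul (hwc.rpow_const fun η => Or.inl (hwpos η).ne')).measurable
  have hmain := lintegral_norm_fourier_rpow_le b hTm
    (fun η => mul_nonneg hA0.le (Real.rpow_nonneg (hwpos η).le _)) hp
    (fun t ht => (hlow t ht).1) (fun t ht => (hlow t ht).2)
  have hrhs : ∫⁻ η, ‖b η‖ₑ ^ 2 * ENNReal.ofReal ((A * w η ^ (1 / p)) ^ (p - 2))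
      ≤ ENNReal.ofReal (A ^ (p - 2) * κ ^ (-(1 / p)) * B) := by
    calc ∫⁻ η, ‖b η‖ₑ ^ 2 * ENNReal.ofReal ((A * w η ^ (1 / p)) ^ (p - 2))
        ≤ ∫⁻ η, ENNReal.ofReal (A ^ (p - 2) * κ ^ (-(1 / p)) * (w η ^ (1 - 1 / p) * ‖b η‖ ^ 2)) := by
          refine lintegral_mono fun η => ?_
          have hwp := hwpos η
          rw [← ofReal_norm, ← ENNReal.ofReal_pow (norm_nonneg _),
            ← ENNReal.ofReal_mul (by positivity)]
          apply ENNReal.ofReal_le_ofReal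
          rw [Real.mul_rpow hA0.le (by positivity), ← Real.rpow_mul hwp.le]
          -- The level function produces order `1 - 2/p`; the surplus `w^(-1/p)` is at most
          -- `κ^(-1/p)`.
          have h1 : w η ^ (1 / p * (p - 2)) ≤ κ ^ (-(1 / p)) * w η ^ (1 - 1 / p) := by
            rw [show 1 / p * (p - 2) = -(1 / p) + (1 - 1 / p) by field_simp; ring,
              Real.rpow_add hwp]
            gcongr ?_ * _
            exact Real.rpow_le_rpow_of_nonpos hκ (le_resolventWeight κ η)
              (by rw [neg_nonpos]; positivity)
          calc ‖b η‖ ^ 2 * (A ^ (p - 2) * w η ^ (1 / p * (p - 2)))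
              ≤ ‖b η‖ ^ 2 * (A ^ (p - 2) * (κ ^ (-(1 / p)) * w η ^ (1 - 1 / p))) := by gcongr
            _ = _ := by ring
      _ = ENNReal.ofReal (∫ η, A ^ (p - 2) * κ ^ (-(1 / p)) * (w η ^ (1 - 1 / p) * ‖b η‖ ^ 2)) := by
          rw [ofReal_integral_eq_lintegral_ofReal (hint.const_mul _)]
          exact Eventually.of_forall fun η => by have := hwpos η; positivity
      _ ≤ _ := by
          apply ENNReal.ofReal_le_ofReal
          rw [integral_const_mul]
          gcongr
  have hfin : ∫⁻ x, ENNReal.ofReal (‖(𝓕 b : L2) x‖ ^ p)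
      ≤ ENNReal.ofReal ((C0 ^ (1 / p) * √D) ^ p) := by
    refine hmain.trans ((mul_le_mul_right hrhs _).trans (le_of_eq ?_))
    rw [← ENNReal.ofReal_mul (by positivity)]
    congr 1
    have hC : (C0 ^ (1 / p) * √D) ^ p = C0 * √D ^ p := by
      rw [Real.mul_rpow (by positivity) (by positivity), ← Real.rpow_mul hC0pos.le,
        one_div_mul_cancel hp0.ne', Real.rpow_one]
    rw [hC, hC0, hA, Real.mul_rpow (by positivity) (by positivity)]
    have h1 : √D ^ p = √D ^ (p - 2) * D := by
      rw [show √D ^ p = √D ^ ((p - 2) + 2) by ring_nf, Real.rpow_add (by positivity), Real.rpow_two,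
        Real.sq_sqrt hD0.le]
    rw [h1, hD]
    ring
  rw [eLpNorm_eq_lintegral_rpow_enorm_toReal (by simpa using hp0) ENNReal.ofReal_ne_top,
    ENNReal.toReal_ofReal hp0.le]
  have hconv : ∫⁻ x, ‖(𝓕 b : L2) x‖ₑ ^ p = ∫⁻ x, ENNReal.ofReal (‖(𝓕 b : L2) x‖ ^ p) := by
    refine lintegral_congr fun x => ?_
    rw [← ofReal_norm, ENNReal.ofReal_rpow_of_nonneg (norm_nonneg _) hp0.le]
  rw [hconv]
  refine (ENNReal.rpow_le_rpow hfin (by positivity)).trans (le_of_eq ?_)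
  rw [ENNReal.ofReal_rpow_of_nonneg (by positivity) (by positivity),
    ← Real.rpow_mul (by positivity), mul_one_div_cancel hp0.ne', Real.rpow_one]

/-! ### Estimates on the operator domain. -/

/-- `e_α` is a lower bound of `-Δ_α`. -/
theorem IsPointLaplacian.bottom_mul_le {α ω : ℝ} {hω : 0 < ω} (hne : ω ≠ -bottom α) {g h : L2}
    (hgh : IsPointLaplacian α hω g h) : bottom α * ‖g‖ ^ 2 ≤ (inner ℂ g h).re := by
  obtain ⟨c, hc⟩ := hgh.exists_charge hne
  have hκ : 0 < -bottom α := neg_pos.2 (bottom_neg α)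
  obtain ⟨h1, h2, h3⟩ := hc _ hκ
  have h4 := (form_add_eq hκ h1 h2 h3).2
  -- At `κ = -e_α` the charge term drops out, so the shifted form is `∫ w |φ|² ≥ 0`.
  have hb : beta α (-bottom α) = 0 := by rw [beta_eq α hκ, sub_self, zero_div]
  have h5 : 0 ≤ ∫ η, resolventWeight (-bottom α) η
      * ‖(𝓕⁻ g : L2) η - c * greenSymbol (-bottom α) η‖ ^ 2 :=
    integral_nonneg fun η => mul_nonneg (resolventWeight_pos hκ η).le (sq_nonneg _)
  rw [hb] at h4
  linarith

/-- The `L^p` norm of an element of the domain of `-Δ_α` in terms of the shifted form. -/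
theorem exists_eLpNorm_le_of_isPointLaplacian (α : ℝ) {p : ℝ} (hp : 2 < p) :
    ∃ C : ℝ, 0 < C ∧ ∀ (ω : ℝ) (hω : 0 < ω), ω ≠ -bottom α → ∀ g h : L2,
      IsPointLaplacian α hω g h → ∀ κ : ℝ, 1 - bottom α ≤ κ →
        0 < (inner ℂ g h).re + κ * ‖g‖ ^ 2 →
        eLpNorm g (ENNReal.ofReal p) volume
          ≤ ENNReal.ofReal (C * κ ^ (-(1 / p)) * √((inner ℂ g h).re + κ * ‖g‖ ^ 2)) := by
  have hp0 : 0 < p := by linarith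
  obtain ⟨C, hC, hsob⟩ := exists_eLpNorm_fourier_le hp
  have hβ0 := beta_one_sub_bottom_pos α
  set β₀ : ℝ := beta α (1 - bottom α) with hβ
  set K : ℝ := p / (4 * Real.pi) with hK
  have hK0 : 0 < K := by positivity
  have hL0 : 0 < 2 + 2 * K / β₀ := by positivity
  refine ⟨C * √(2 + 2 * K / β₀), by positivity, fun ω hω hne g h hgh κ hκ' hE => ?_⟩
  have hκ0 : 0 < 1 - bottom α := by linarith [bottom_neg α]
  have hκ : 0 < κ := hκ0.trans_le hκ'
  obtain ⟨c, hc⟩ := hgh.exists_charge hne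
  obtain ⟨h1, h2, h3⟩ := hc κ hκ
  obtain ⟨hwi, hform⟩ := form_add_eq hκ h1 h2 h3
  set E : ℝ := (inner ℂ g h).re + κ * ‖g‖ ^ 2 with hEdef
  set b : L2 := 𝓕⁻ g with hb
  set w := resolventWeight κ with hw
  have hwpos : ∀ η, 0 < w η := resolventWeight_pos hκ
  have hwc : Continuous w := continuous_resolventWeight κ
  set I : ℝ := ∫ η, w η * ‖b η - c * greenSymbol κ η‖ ^ 2 with hI
  have hI0 : 0 ≤ I := integral_nonneg fun η => mul_nonneg (hwpos η).le (sq_nonneg _)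
  have hβκ : β₀ ≤ beta α κ := beta_mono hκ0 hκ'
  have hcE : β₀ * ‖c‖ ^ 2 + I ≤ E := by
    have := mul_le_mul_of_nonneg_right hβκ (sq_nonneg ‖c‖)
    linarith
  obtain ⟨hi2, hv2⟩ := integral_resolventWeight_rpow hκ (s := 1 + 1 / p) (by simpa using hp0)
  have hdom : Integrable (fun η => 2 * κ ^ (-(1 / p)) * (w η * ‖b η - c * greenSymbol κ η‖ ^ 2)
      + 2 * ‖c‖ ^ 2 * w η ^ (-(1 + 1 / p))) := (hwi.const_mul _).add (hi2.const_mul _)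
  -- The weight stays below order 1 because `w * w⁻²` is not integrable, whereas `w^(1-1/p) * w⁻² =
  -- w^(-(1+1/p))` is, with integral `K κ^(-1/p)`. The regular part gains the same `κ^(-1/p)` from
  -- `w ≥ κ`.
  have hpt : ∀ η, w η ^ (1 - 1 / p) * ‖b η‖ ^ 2
      ≤ 2 * κ ^ (-(1 / p)) * (w η * ‖b η - c * greenSymbol κ η‖ ^ 2)
        + 2 * ‖c‖ ^ 2 * w η ^ (-(1 + 1 / p)) := by
    intro η
    have hwp := hwpos η
    have hG : ‖c * greenSymbol κ η‖ ^ 2 = ‖c‖ ^ 2 * w η ^ (-2 : ℝ) := by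
      rw [norm_mul, greenSymbol_eq, Complex.norm_real, Real.norm_of_nonneg (inv_pos.2 hwp).le,
        mul_pow, Real.rpow_neg hwp.le, Real.rpow_two, inv_pow]
    have h4 : ‖b η‖ ^ 2 ≤ 2 * ‖b η - c * greenSymbol κ η‖ ^ 2 + 2 * (‖c‖ ^ 2 * w η ^ (-2 : ℝ)) := by
      rw [← hG]
      have h5 : ‖b η‖ ≤ ‖b η - c * greenSymbol κ η‖ + ‖c * greenSymbol κ η‖ := by
        simpa using norm_add_le (b η - c * greenSymbol κ η) (c * greenSymbol κ η)
      have h6 := pow_le_pow_left₀ (norm_nonneg _) h5 2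
      linarith [sq_nonneg (‖b η - c * greenSymbol κ η‖ - ‖c * greenSymbol κ η‖)]
    have h7 : w η ^ (1 - 1 / p) ≤ κ ^ (-(1 / p)) * w η := by
      rw [show 1 - 1 / p = -(1 / p) + 1 by ring, Real.rpow_add hwp, Real.rpow_one]
      gcongr ?_ * _
      exact Real.rpow_le_rpow_of_nonpos hκ (le_resolventWeight κ η)
        (by rw [neg_nonpos]; positivity)
    have h8 : w η ^ (1 - 1 / p) * w η ^ (-2 : ℝ) = w η ^ (-(1 + 1 / p)) := by
      rw [← Real.rpow_add hwp]
      congr 1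
      ring
    calc w η ^ (1 - 1 / p) * ‖b η‖ ^ 2
        ≤ w η ^ (1 - 1 / p) * (2 * ‖b η - c * greenSymbol κ η‖ ^ 2
          + 2 * (‖c‖ ^ 2 * w η ^ (-2 : ℝ))) := by gcongr
      _ = 2 * w η ^ (1 - 1 / p) * ‖b η - c * greenSymbol κ η‖ ^ 2
          + 2 * ‖c‖ ^ 2 * (w η ^ (1 - 1 / p) * w η ^ (-2 : ℝ)) := by ring
      _ ≤ 2 * (κ ^ (-(1 / p)) * w η) * ‖b η - c * greenSymbol κ η‖ ^ 2
          + 2 * ‖c‖ ^ 2 * w η ^ (-(1 + 1 / p)) := by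
        rw [h8]
        gcongr
      _ = _ := by ring
  have hint : Integrable (fun η => w η ^ (1 - 1 / p) * ‖b η‖ ^ 2) := by
    refine hdom.mono' ?_ (Eventually.of_forall fun η => ?_)
    · exact (hwc.rpow_const fun η => Or.inl (hwpos η).ne').aestronglyMeasurable.mul
        ((Lp.aestronglyMeasurable b).norm.pow 2)
    · have hwp := hwpos η
      rw [Real.norm_of_nonneg (by positivity)]
      exact hpt η
  have hM : ∫ η, w η ^ (1 - 1 / p) * ‖b η‖ ^ 2 ≤ κ ^ (-(1 / p)) * ((2 + 2 * K / β₀) * E) := by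
    calc ∫ η, w η ^ (1 - 1 / p) * ‖b η‖ ^ 2
        ≤ ∫ η, (2 * κ ^ (-(1 / p)) * (w η * ‖b η - c * greenSymbol κ η‖ ^ 2)
          + 2 * ‖c‖ ^ 2 * w η ^ (-(1 + 1 / p))) := integral_mono hint hdom hpt
      _ = κ ^ (-(1 / p)) * (2 * I + 2 * K * ‖c‖ ^ 2) := by
        rw [integral_add (hwi.const_mul _) (hi2.const_mul _), integral_const_mul,
          integral_const_mul, hv2, ← hI, show 1 - (1 + 1 / p) = -(1 / p) by ring,
          show 1 + 1 / p - 1 = 1 / p by ring, hK]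
        field_simp
      _ ≤ _ := by
        gcongr
        have h4 : ‖c‖ ^ 2 ≤ E / β₀ := by
          rw [le_div_iff₀ hβ0]
          linarith
        have h5 : I ≤ E := by
          have : 0 ≤ β₀ * ‖c‖ ^ 2 := by positivity
          linarith
        calc 2 * I + 2 * K * ‖c‖ ^ 2 ≤ 2 * E + 2 * K * (E / β₀) := by gcongr
          _ = _ := by ring
  have hres := hsob κ hκ _ (by positivity) b hint hM
  rw [hb, FourierTransform.fourier_fourierInv_eq] at hres
  refine hres.trans (le_of_eq ?_)
  congr 1
  rw [show κ ^ (-(1 / p)) * ((2 + 2 * K / β₀) * E) * κ ^ (-(1 / p))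
      = (κ ^ (-(1 / p))) ^ 2 * ((2 + 2 * K / β₀) * E) by ring,
    Real.sqrt_mul (by positivity), Real.sqrt_sq (by positivity), Real.sqrt_mul hL0.le]
  ring

/-- The Gagliardo–Nirenberg inequality on the domain of `-Δ_α`. -/
theorem exists_eLpNorm_le_energy (α : ℝ) {p : ℝ} (hp : 2 ≤ p) :
    ∃ C : ℝ, 0 < C ∧ ∀ (ω : ℝ) (hω : 0 < ω), ω ≠ -bottom α → ∀ g h : L2,
      IsPointLaplacian α hω g h →
        eLpNorm g (ENNReal.ofReal p) volume
          ≤ ENNReal.ofReal (C * √((inner ℂ g h).re + (1 - bottom α) * ‖g‖ ^ 2) ^ (1 - 2 / p)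
            * ‖g‖ ^ (2 / p)) := by
  rcases hp.eq_or_lt with rfl | hp2
  · refine ⟨1, one_pos, fun ω hω hne g h hgh => le_of_eq ?_⟩
    simp only [ENNReal.ofReal_ofNat]
    rw [div_self two_ne_zero, sub_self, Real.rpow_zero, Real.rpow_one, one_mul, one_mul,
      Lp.norm_def, ENNReal.ofReal_toReal (Lp.eLpNorm_ne_top g)]
  have hp0 : 0 < p := by linarith
  obtain ⟨C, hC, hbound⟩ := exists_eLpNorm_le_of_isPointLaplacian α hp2
  refine ⟨C * √2, by positivity, fun ω hω hne g h hgh => ?_⟩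
  rcases eq_or_ne g 0 with rfl | hg
  · rw [eLpNorm_congr_ae (Lp.coeFn_zero ℂ 2 volume), eLpNorm_zero]
    exact zero_le
  have hg0 : 0 < ‖g‖ := norm_pos_iff.2 hg
  have hlow := hgh.bottom_mul_le hne
  set N2 : ℝ := (inner ℂ g h).re + (1 - bottom α) * ‖g‖ ^ 2 with hN2
  -- The spectral bound gives `N2 ≥ ‖g‖²`, by the `1` in `1 - e_α`.
  have hN0 : 0 < N2 := by
    have : 0 < ‖g‖ ^ 2 := by positivity
    linarith
  -- The choice `κ = 1 - e_α + N2 / ‖g‖²` only doubles the energy, while `κ^(-1/p) ≤ (√N2 /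
  -- ‖g‖)^(-2/p)` supplies the interpolation.
  have hE : (inner ℂ g h).re + (1 - bottom α + N2 / ‖g‖ ^ 2) * ‖g‖ ^ 2 = 2 * N2 := by
    rw [add_mul, div_mul_cancel₀ _ (by positivity)]
    linarith
  have hκ : N2 / ‖g‖ ^ 2 ≤ 1 - bottom α + N2 / ‖g‖ ^ 2 := by linarith [bottom_neg α]
  have hres := hbound ω hω hne g h hgh (1 - bottom α + N2 / ‖g‖ ^ 2)
    (le_add_of_nonneg_right (by positivity)) (by rw [hE]; positivity)
  rw [hE] at hres
  refine hres.trans (ENNReal.ofReal_le_ofReal ?_)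
  have h1 : (1 - bottom α + N2 / ‖g‖ ^ 2) ^ (-(1 / p)) ≤ (N2 / ‖g‖ ^ 2) ^ (-(1 / p)) :=
    Real.rpow_le_rpow_of_nonpos (by positivity) hκ (by rw [neg_nonpos]; positivity)
  have h2 : (N2 / ‖g‖ ^ 2) ^ (-(1 / p)) = √N2 ^ (-(2 / p)) * ‖g‖ ^ (2 / p) := by
    have e : N2 / ‖g‖ ^ 2 = (√N2 / ‖g‖) ^ (2 : ℝ) := by
      rw [Real.rpow_two, div_pow, Real.sq_sqrt hN0.le]
    rw [e, ← Real.rpow_mul (by positivity), show (2 : ℝ) * -(1 / p) = -(2 / p) by ring,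
      Real.div_rpow (by positivity) hg0.le, Real.rpow_neg hg0.le, div_inv_eq_mul]
  calc C * (1 - bottom α + N2 / ‖g‖ ^ 2) ^ (-(1 / p)) * √(2 * N2)
      ≤ C * (√N2 ^ (-(2 / p)) * ‖g‖ ^ (2 / p)) * √(2 * N2) := by
        rw [← h2]
        gcongr
    _ = C * √2 * (√N2 * √N2 ^ (-(2 / p))) * ‖g‖ ^ (2 / p) := by
        rw [Real.sqrt_mul zero_le_two]
        ring
    _ = _ := by
        rw [show 1 - 2 / p = 1 + -(2 / p) by ring, Real.rpow_add (by positivity), Real.rpow_one]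

end PointInteraction

end

/-! ### Passage to the form domain. -/

theorem corollary2p5 (α : ℝ) (p : ℝ) (hp : 2 ≤ p) :
    ∃ C : ℝ, 0 < C ∧
      ∀ (ω : ℝ) (hω : 0 < ω), ω ≠ -PointInteraction.bottom α →
        ∀ g ∈ PointInteraction.energySpace α hω,
          MemLp g (ENNReal.ofReal p) volume ∧
          (eLpNorm g (ENNReal.ofReal p) volume).toReal
            ≤ C * PointInteraction.energyNorm α hω g ^ (1 - 2 / p) * ‖g‖ ^ (2 / p) := by
  obtain ⟨C, hC, hbound⟩ := PointInteraction.exists_eLpNorm_le_energy α hp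
  refine ⟨C, hC, fun ω hω hne g hg => ?_⟩
  have hp0 : 0 < p := by linarith
  have hg' : ∃ Q, PointInteraction.IsClosedFormValue α hω g Q := hg
  have hnn : 0 ≤ 1 - 2 / p := by
    rw [sub_nonneg, div_le_one hp0]
    exact hp
  have hnorm : PointInteraction.energyNorm α hω g
      = √(hg'.choose + (1 - PointInteraction.bottom α) * ‖g‖ ^ 2) := by
    rw [PointInteraction.energyNorm, PointInteraction.quadForm, dif_pos hg']
  -- The sequence realizes the very value picked by `choose`, so the estimate holds whichever value
  -- that is.
  obtain ⟨u, v, huv, hu, -, hQ⟩ := hg'.choose_spec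
  rw [hnorm]
  set Q : ℝ := hg'.choose
  have hlim : Tendsto (fun n => ENNReal.ofReal (C * √((inner ℂ (u n) (v n)).re
      + (1 - PointInteraction.bottom α) * ‖u n‖ ^ 2) ^ (1 - 2 / p) * ‖u n‖ ^ (2 / p))) atTop
      (𝓝 (ENNReal.ofReal (C * √(Q + (1 - PointInteraction.bottom α) * ‖g‖ ^ 2) ^ (1 - 2 / p)
        * ‖g‖ ^ (2 / p)))) := by
    refine ENNReal.tendsto_ofReal ((Tendsto.const_mul C ?_).mul
      (hu.norm.rpow_const (Or.inr (by positivity))))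
    exact (hQ.add ((hu.norm.pow 2).const_mul _)).sqrt.rpow_const (Or.inr hnn)
  -- `L²` convergence gives a subsequence converging almost everywhere, to which Fatou's lemma in
  -- `L^p` applies.
  obtain ⟨ns, hns, hae⟩ := (tendstoInMeasure_of_tendsto_Lp hu).exists_seq_tendsto_ae
  have hle : eLpNorm g (ENNReal.ofReal p) volume ≤ ENNReal.ofReal
      (C * √(Q + (1 - PointInteraction.bottom α) * ‖g‖ ^ 2) ^ (1 - 2 / p) * ‖g‖ ^ (2 / p)) := by
    refine (Lp.eLpNorm_lim_le_liminf_eLpNorm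
      (fun n => Lp.aestronglyMeasurable (u (ns n))) _ hae).trans ?_
    rw [← (hlim.comp hns.tendsto_atTop).liminf_eq]
    exact liminf_le_liminf (Eventually.of_forall fun n => hbound ω hω hne _ _ (huv (ns n)))
  refine ⟨⟨Lp.aestronglyMeasurable g, hle.trans_lt ENNReal.ofReal_lt_top⟩, ?_⟩
  exact ENNReal.toReal_le_of_le_ofReal (by positivity) hle
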